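/- Let $G$ be a Lie group with Lie algebra $\mathfrak g$, acting smoothly (from the left) on a smooth manifold $M$. For $x\in\mathfrak g$ let $v_x$ be the infinitesimal generator, $v_x(p)=\frac{d}{dt}\big|_{t=0}\exp(-tx)\cdot p$. The Cartan model is the complex $(\Omega(M)\otimes S\mathfrak g^*)^G$ of $G$-equivariant polynomial maps $C\colon\mathfrak g\to\Omega(M)$, with differential $(d_GC)(x)=d(C(x))-\iota_{v_x}(C(x))$. Put $\Omega^j(M)=0$ for $j<0$. Let $n\ge 0$ be an integer, and for $i=0,1$ let $\omega^i\in\Omega^{n+1}(M)^G$ and $\mu^i\in(\Omega^{n-1}(M)\otimes\mathfrak g^*)^G$ be such that $C^i:=\omega^i-\mu^i$ is a cocycle in the Cartan model. Suppose that there is a $G$-equivariant diffeomorphism $\psi\colon M\to M$ with $\psi^*\omega^1=\omega^0$ and $\psi^*(\mu^1(x))=\mu^0(x)$ for all $x\in\mathfrak g$, which is isotopic to $\mathrm{Id}_M$ by $G$-equivariant diffeomorphisms, i.e. there are $G$-equivariant diffeomorphisms $\psi_s$, $s\in[0,1]$, with $\psi_0=\mathrm{Id}_M$ and $\psi_1=\psi$,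 such that $(s,p)\mapsto\psi_s(p)$ is smooth on $[0,1]\times M$. Then $C^0$ and $C^1$ are equivalent: there exist $\alpha\in\Omega^n(M)^G$ and $F\in(\Omega^{n-2}(M)\otimes\mathfrak g^*)^G$ with $$C^1-C^0=d_G(\alpha+F).$$ Explicitly, this means that $\omega^1-\omega^0=d\alpha$, that $\mu^1(x)-\mu^0(x)=\iota_{v_x}\alpha-d(F(x))$ and that $\iota_{v_x}F(x)=0$ for all $x\in\mathfrak g$. -/

import Mathlib

open scoped Manifold ContDiff Topology

noncomputable section

namespace EquivForms

/-! ### Differential forms on a manifold without boundary -/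

section Forms

variable {E : Type*} [NormedAddCommGroup E] [NormedSpace ℝ E]
  {M : Type*} [TopologicalSpace M] [ChartedSpace E M]

variable (E M) in
/-- A (not necessarily smooth) differential form on `M` of mixed degree: the family of its
homogeneous components, the component of degree `k` being a field of alternating `k`-linear forms
on the tangent spaces. -/
abbrev GradedForm : Type _ :=
  ∀ k : ℕ, ∀ p : M, (TangentSpace 𝓘(ℝ, E) p) [⋀^Fin k]→L[ℝ] ℝ

/-- The local representative of a `k`-form in the preferred chart around `p`, that is, its pullback
by the inverse of this chart (meaningful on the target of the chart). -/
def formInChart {k : ℕ} (β : ∀ p : M, (TangentSpace 𝓘(ℝ, E) p) [⋀^Fin k]→L[ℝ] ℝ) (p : M) :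
    E → E [⋀^Fin k]→L[ℝ] ℝ := fun y =>
  (β ((extChartAt 𝓘(ℝ, E) p).symm y)).compContinuousLinearMap
    (mfderiv 𝓘(ℝ, E) 𝓘(ℝ, E) (extChartAt 𝓘(ℝ, E) p).symm y)

/-- Smoothness (in charts) of all homogeneous components of a form. -/
def IsSmoothForm (β : GradedForm E M) : Prop :=
  ∀ (k : ℕ) (p : M),
    ContDiffOn ℝ ∞ (formInChart (β k) p) (extChartAt 𝓘(ℝ, E) p).target

/-- `β` is homogeneous of degree `j`. The degree is an integer, so that for `j < 0` only the zero
form is homogeneous of degree `j`. -/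
def IsHomogeneousForm (j : ℤ) (β : GradedForm E M) : Prop :=
  ∀ k : ℕ, (k : ℤ) ≠ j → β k = 0

/-- The exterior derivative of a `k`-form, at `p` computed in the preferred chart around `p`. -/
def extDerivForm {k : ℕ} (β : ∀ p : M, (TangentSpace 𝓘(ℝ, E) p) [⋀^Fin k]→L[ℝ] ℝ) :
    ∀ p : M, (TangentSpace 𝓘(ℝ, E) p) [⋀^Fin (k + 1)]→L[ℝ] ℝ := fun p =>
  (extDeriv (formInChart β p) (extChartAt 𝓘(ℝ, E) p p)).compContinuousLinearMap
    (mfderiv 𝓘(ℝ, E) 𝓘(ℝ, E) (extChartAt 𝓘(ℝ, E) p) p)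

/-- The de Rham differential. -/
def deRham (β : GradedForm E M) : GradedForm E M
  | 0 => 0
  | k + 1 => extDerivForm (β k)

/-- Insertion of a vector `v` as first argument of an alternating form. -/
def insertVector {V : Type*} [AddCommGroup V] [Module ℝ V] [TopologicalSpace V] {k : ℕ} (v : V)
    (f : V [⋀^Fin (k + 1)]→L[ℝ] ℝ) : V [⋀^Fin k]→L[ℝ] ℝ :=
  { f.toAlternatingMap.curryLeft v with
    cont := f.cont.comp (continuous_const.finCons continuous_id) }

/-- Contraction `ι_X β` of a form with a vector field. -/
def contract (X : ∀ p : M, TangentSpace 𝓘(ℝ, E) p) (β : GradedForm E M) : GradedForm E M :=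
  fun k p => insertVector (X p) (β (k + 1) p)

/-- The pullback `f^* β`. -/
def pullback (f : M → M) (β : GradedForm E M) : GradedForm E M := fun k p =>
  (β k (f p)).compContinuousLinearMap (mfderiv 𝓘(ℝ, E) 𝓘(ℝ, E) f p)

end Forms

/-! ### The Cartan model of a smooth action of a Lie group -/

section Action

variable {E : Type*} [NormedAddCommGroup E] [NormedSpace ℝ E]
  {M : Type*} [TopologicalSpace M] [ChartedSpace E M]
  {EG : Type*} [NormedAddCommGroup EG] [NormedSpace ℝ EG]
  {G : Type*} [TopologicalSpace G] [ChartedSpace EG G] [Group G]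

/-- The adjoint action of `g` on the Lie algebra: the derivative at `1` of conjugation by `g`. -/
def Ad (g : G) (x : GroupLieAlgebra 𝓘(ℝ, EG) G) : GroupLieAlgebra 𝓘(ℝ, EG) G :=
  (mfderiv 𝓘(ℝ, EG) 𝓘(ℝ, EG) (fun h : G => g * h * g⁻¹) 1 :
    TangentSpace 𝓘(ℝ, EG) (1 : G) →L[ℝ] TangentSpace 𝓘(ℝ, EG) (g * 1 * g⁻¹)) x

variable [MulAction G M]

variable (E M) in
/-- The infinitesimal generator `v_x` of the action: `v_x(p)` is the derivative at `t = 0` of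
`exp(-t x) • p`. With this sign `x ↦ v_x` is a morphism of Lie algebras. -/
def generator (x : GroupLieAlgebra 𝓘(ℝ, EG) G) (p : M) : TangentSpace 𝓘(ℝ, E) p :=
  -((mfderiv 𝓘(ℝ, EG) 𝓘(ℝ, E) (fun g : G => g • p) 1 :
    TangentSpace 𝓘(ℝ, EG) (1 : G) →L[ℝ] TangentSpace 𝓘(ℝ, E) ((1 : G) • p)) x)

variable (E M EG G) in
/-- Maps from the Lie algebra `𝔤` to forms. The algebra `Ω(M) ⊗ S𝔤^*` consists of those which are
polynomial with values in smooth forms. -/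
abbrev CartanMap : Type _ := GroupLieAlgebra 𝓘(ℝ, EG) G → GradedForm E M

variable (E M EG G) in
/-- `Ω(M) ⊗ S𝔤^*`, as the space of polynomial maps from `𝔤` to `Ω(M)`: the linear span of the maps
`x ↦ ξ₁(x) ⋯ ξᵣ(x) β` with `ξ₁, …, ξᵣ ∈ 𝔤^*` and `β` a smooth form. -/
def polynomialMaps : Submodule ℝ (CartanMap E M EG G) :=
  Submodule.span ℝ {C | ∃ (l : List (Module.Dual ℝ (GroupLieAlgebra 𝓘(ℝ, EG) G)))
    (β : GradedForm E M), IsSmoothForm β ∧ C = fun x => (l.map (fun ξ => ξ x)).prod • β}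

/-- `G`-invariance in `Ω(M) ⊗ S𝔤^*`, that is, equivariance of the map `𝔤 → Ω(M)`. -/
def IsEquivariantMap (C : CartanMap E M EG G) : Prop :=
  ∀ (g : G) (x : GroupLieAlgebra 𝓘(ℝ, EG) G), pullback (fun p : M => g • p) (C (Ad g x)) = C x

/-- The Cartan differential `(d_G C)(x) = d (C x) - ι_{v_x} (C x)`. -/
def cartanDifferential (C : CartanMap E M EG G) : CartanMap E M EG G :=
  fun x => deRham (C x) - contract (generator E M x) (C x)

/-- `C` is a cocycle in the Cartan model `((Ω(M) ⊗ S𝔤^*)^G, d_G)`. -/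
def IsCartanCocycle (C : CartanMap E M EG G) : Prop :=
  C ∈ polynomialMaps E M EG G ∧ IsEquivariantMap C ∧ cartanDifferential C = 0

variable (E M G) in
/-- `Ω^j(M)^G`: the smooth `G`-invariant `j`-forms. -/
def invariantForms (j : ℤ) : Set (GradedForm E M) :=
  {β | IsSmoothForm β ∧ IsHomogeneousForm j β ∧ ∀ g : G, pullback (fun p : M => g • p) β = β}

variable (E M EG G) in
/-- `(Ω^j(M) ⊗ 𝔤^*)^G`: the linear `G`-equivariant maps from `𝔤` to the smooth `j`-forms. -/
def equivariantLinearForms (j : ℤ) : Set (GroupLieAlgebra 𝓘(ℝ, EG) G →ₗ[ℝ] GradedForm E M) :=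
  {μ | (∀ x, IsSmoothForm (μ x) ∧ IsHomogeneousForm j (μ x)) ∧ IsEquivariantMap (fun x => μ x)}

/-- The element `β ⊗ 1 + F` of `Ω(M) ⊗ S𝔤^*`, for `β ∈ Ω(M)` and `F ∈ Ω(M) ⊗ 𝔤^*`. -/
def cartanSum (β : GradedForm E M) (F : GroupLieAlgebra 𝓘(ℝ, EG) G →ₗ[ℝ] GradedForm E M) :
    CartanMap E M EG G := fun x => β + F x

/-- Equivalence of the cocycles `C⁰`, `C¹` (of degree `n + 1`): they differ by a coboundary
`d_G (α + F)` with `α ∈ Ω^n(M)^G` and `F ∈ (Ω^{n-2}(M) ⊗ 𝔤^*)^G`. The last clause, `ι_{v_x} F(x) = 0`,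
is for cocycles of the form `ω - μ` the component of the equation in form degree `n - 3`. -/
def CartanEquivalent (n : ℕ) (C₀ C₁ : CartanMap E M EG G) : Prop :=
  ∃ α ∈ invariantForms E M G (n : ℤ), ∃ F ∈ equivariantLinearForms E M EG G ((n : ℤ) - 2),
    C₁ - C₀ = cartanDifferential (cartanSum α F) ∧
      ∀ x, contract (generator E M x) (F x) = 0

variable (G) in
/-- `ψ` is isotopic to the identity through `G`-equivariant diffeomorphisms: there are
diffeomorphisms `Ψ s`, for `s` in `[0, 1]` equivariant and jointly smooth in `s` and the point,
with `Ψ 0 = id` and `Ψ 1 = ψ`. (The values of `Ψ` outside `[0, 1]` play no role.) -/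
def EquivariantlyIsotopicToId (ψ : M ≃ₘ⟮𝓘(ℝ, E), 𝓘(ℝ, E)⟯ M) : Prop :=
  ∃ Ψ : ℝ → (M ≃ₘ⟮𝓘(ℝ, E), 𝓘(ℝ, E)⟯ M),
    ContMDiffOn (𝓘(ℝ, ℝ).prod 𝓘(ℝ, E)) 𝓘(ℝ, E) ∞ (fun q : ℝ × M => Ψ q.1 q.2)
      (Set.Icc (0 : ℝ) 1 ×ˢ Set.univ) ∧
    (∀ p, Ψ 0 p = p) ∧ (∀ p, Ψ 1 p = ψ p) ∧
    ∀ s ∈ Set.Icc (0 : ℝ) 1, ∀ (g : G) (p : M), Ψ s (g • p) = g • Ψ s p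

end Action

end EquivForms

end

/-!
The two cocycles are related by a Cartan homotopy operator that is compatible with the action.

Reparametrizing the given isotopy by a smooth cutoff and reversing time
(`EquivariantlyIsotopicToId.exists_contMDiff`) yields a smooth family of equivariant maps `H s`,
`s ∈ ℝ`, with `H 0 = ψ` and `H 1 = id`. The operator `K β = ∫₀¹ ι_{∂/∂s} (H^* β) ds`
(`homotopyOperator`) preserves smoothness and satisfies `d K + K d = (H 1)^* - (H 0)^*`
(`deRham_homotopyOperator_add`). Since every `H s` is equivariant, it preserves the infinitesimal
generators (`mderiv_generator`); hence `K` commutes with the action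
(`pullback_homotopyOperator`) and anticommutes with `ι_{v_x}` (`homotopyOperator_contract`), so
that on the Cartan model `d_G K + K d_G = id - ψ^*`.

Applied to the cocycle `C¹` this reads `d_G (K C¹) = C¹ - ψ^* C¹ = C¹ - C⁰`, which gives `α = K ω¹`
and `F = -K μ¹`. The remaining condition `ι_{v_x} F(x) = 0` follows from `ι_{v_x} μ¹(x) = 0`, the
component of the cocycle equation in lowest form degree
(`IsCartanCocycle.contract_generator_eq_zero`).

The homotopy formula is checked in a chart of `M` around the given point: there `H` becomes a map
from `ℝ × E` to `M`, the exterior derivative commutes with the pullback by this map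
(`IsSmoothForm.extDeriv_pullbackVec`), and on `ℝ × E` the integrand is the derivative along
`∂/∂s`, by Cartan's formula (`extDeriv_slice_add`). The fundamental theorem of calculus and
differentiation under the integral sign (`hasFDerivAt_integral_of_contDiffAt`) conclude.
-/

noncomputable section

namespace EquivForms

/-! ### Calculus of alternating maps and parametric integrals -/

section Calculus

open ContinuousAlternatingMap

/-- Antisymmetrization of continuous multilinear maps, normalized so as to be a left inverse of
the inclusion of alternating maps into multilinear maps. -/
def antisymmetrizeCLM (ι V : Type*) [Fintype ι] [DecidableEq ι] [NormedAddCommGroup V]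
    [NormedSpace ℝ V] :
    ContinuousMultilinearMap ℝ (fun _ : ι => V) ℝ →L[ℝ] V [⋀^ι]→L[ℝ] ℝ :=
  LinearMap.mkContinuous
    { toFun := fun f => ((Fintype.card ι).factorial : ℝ)⁻¹ •
        ContinuousMultilinearMap.alternatization f
      map_add' := fun f g => by rw [map_add, smul_add]
      map_smul' := fun c f => by
        ext v
        simp only [ContinuousAlternatingMap.smul_apply, RingHom.id_apply,
          ContinuousMultilinearMap.alternatization_apply_apply,
          _root_.smul_apply, Finset.smul_sum]
        refine Finset.sum_congr rfl fun σ _ => ?_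
        rw [smul_comm c, smul_comm c] } 1 <| by
    intro f
    refine ContinuousAlternatingMap.opNorm_le_bound _ (by positivity) fun v => ?_
    have hle : ‖∑ σ : Equiv.Perm ι, Equiv.Perm.sign σ • f (v ∘ σ)‖
        ≤ (Fintype.card ι).factorial * (‖f‖ * ∏ i, ‖v i‖) := by
      refine (norm_sum_le _ _).trans ?_
      rw [← Fintype.card_perm, ← nsmul_eq_mul, ← Finset.card_univ]
      refine Finset.sum_le_card_nsmul _ _ _ fun σ _ => ?_
      have h := f.le_opNorm (v ∘ σ)
      simp only [Function.comp_apply] at h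
      rw [Equiv.prod_comp σ (fun i => ‖v i‖)] at h
      refine le_trans (le_of_eq ?_) h
      rcases Int.units_eq_one_or (Equiv.Perm.sign σ) with hσ | hσ <;> simp [hσ, Units.smul_def]
    have hpos : (0 : ℝ) < (Fintype.card ι).factorial := by positivity
    simp only [LinearMap.coe_mk, AddHom.coe_mk, ContinuousAlternatingMap.smul_apply,
      ContinuousMultilinearMap.alternatization_apply_apply, norm_smul, norm_inv,
      RCLike.norm_natCast, one_mul]
    rw [inv_mul_le_iff₀ hpos]
    exact hle

theorem antisymmetrizeCLM_toContinuousMultilinearMap {ι V : Type*} [Fintype ι] [DecidableEq ι]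
    [NormedAddCommGroup V] [NormedSpace ℝ V] (f : V [⋀^ι]→L[ℝ] ℝ) :
    antisymmetrizeCLM ι V f.toContinuousMultilinearMap = f := by
  ext v
  have hsum : ∑ σ : Equiv.Perm ι, Equiv.Perm.sign σ • f (v ∘ σ)
      = ((Fintype.card ι).factorial : ℝ) * f v := by
    rw [← Fintype.card_perm, ← nsmul_eq_mul, ← Finset.card_univ, ← Finset.sum_const]
    refine Finset.sum_congr rfl fun σ _ => ?_
    have h : f (v ∘ σ) = Equiv.Perm.sign σ • f v := f.toAlternatingMap.map_perm v σ
    rw [h, smul_smul, Int.units_mul_self, one_smul]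
  simp only [antisymmetrizeCLM, LinearMap.mkContinuous_apply, LinearMap.coe_mk, AddHom.coe_mk,
    ContinuousAlternatingMap.smul_apply, ContinuousMultilinearMap.alternatization_apply_apply,
    ContinuousAlternatingMap.coe_toContinuousMultilinearMap, hsum, smul_eq_mul]
  rw [inv_mul_cancel_left₀]
  positivity

/-- The pullback `f.compContinuousLinearMap g` depends smoothly on the pair `(f, g)`: it is
polynomial in `g` and linear in `f`. -/
theorem ContDiffAt.compContinuousLinearMap {ι X V V' : Type*} [Fintype ι]
    [NormedAddCommGroup X] [NormedSpace ℝ X] [NormedAddCommGroup V] [NormedSpace ℝ V]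
    [NormedAddCommGroup V'] [NormedSpace ℝ V'] {m : WithTop ℕ∞}
    {f : X → V' [⋀^ι]→L[ℝ] ℝ} {g : X → V →L[ℝ] V'} {x : X}
    (hf : ContDiffAt ℝ m f x) (hg : ContDiffAt ℝ m g x) :
    ContDiffAt ℝ m (fun y => (f y).compContinuousLinearMap (g y)) x := by
  classical
  have h1 : ContDiffAt ℝ m (fun y =>
      ContinuousMultilinearMap.compContinuousLinearMapContinuousMultilinear
        ℝ (fun _ : ι => V) (fun _ : ι => V') ℝ (fun _ => g y)) x :=
    (ContinuousMultilinearMap.contDiff _).contDiffAt.comp x (contDiffAt_pi.2 fun _ => hg)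
  have h2 : ContDiffAt ℝ m (fun y => toContinuousMultilinearMapCLM ℝ (f y)) x :=
    (toContinuousMultilinearMapCLM ℝ : (V' [⋀^ι]→L[ℝ] ℝ) →L[ℝ] _).contDiff.contDiffAt.comp x hf
  have h3 := (antisymmetrizeCLM ι V).contDiff.contDiffAt.comp x (h1.clm_apply h2)
  refine h3.congr_of_eventuallyEq (Filter.Eventually.of_forall fun y => ?_)
  exact (antisymmetrizeCLM_toContinuousMultilinearMap
    ((f y).compContinuousLinearMap (g y))).symm

variable {X F : Type*} [NormedAddCommGroup X] [NormedSpace ℝ X] [NormedAddCommGroup F]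
  [NormedSpace ℝ F]

/-- The partial derivative in the second variable of a smooth function is jointly smooth. -/
theorem ContDiffAt.fderiv_slice {g : ℝ × X → F} {s : ℝ} {y : X}
    (hg : ContDiffAt ℝ ∞ g (s, y)) :
    ContDiffAt ℝ ∞ (fun q : ℝ × X => fderiv ℝ (fun z => g (q.1, z)) q.2) (s, y) := by
  have h1 : ContDiffAt ℝ ∞ (fun q : ℝ × X => (fderiv ℝ g q).comp (ContinuousLinearMap.inr ℝ ℝ X))
      (s, y) := (hg.fderiv_right (m := ∞) (by simp)).clm_comp contDiffAt_const
  refine h1.congr_of_eventuallyEq ?_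
  have h2 : ContDiffAt ℝ 1 g (s, y) := hg.of_le (by exact_mod_cast le_top)
  filter_upwards [h2.eventually (by simp)] with q hq
  have h3 : HasFDerivAt g (fderiv ℝ g q) (q.1, q.2) :=
    (hq.differentiableAt one_ne_zero).hasFDerivAt
  exact (h3.comp q.2 (hasFDerivAt_prodMk_right q.1 q.2)).fderiv

theorem continuous_slice_of_contDiffAt {g : ℝ × X → F} {y : X}
    (hg : ∀ s, ContDiffAt ℝ ∞ g (s, y)) : Continuous fun s => g (s, y) :=
  continuous_iff_continuousAt.2 fun s =>
    (hg s).continuousAt.comp (f := fun t : ℝ => (t, y)) (by fun_prop)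

/-- Differentiation under the integral sign for a smooth family of functions. -/
theorem hasFDerivAt_integral_of_contDiffAt [FiniteDimensional ℝ X] [CompleteSpace F]
    {g : ℝ × X → F} {U : Set X} (hU : IsOpen U)
    (hg : ∀ s, ∀ y ∈ U, ContDiffAt ℝ ∞ g (s, y)) (a b : ℝ) {y : X} (hy : y ∈ U) :
    HasFDerivAt (fun z => ∫ s in a..b, g (s, z))
      (∫ s in a..b, fderiv ℝ (fun z => g (s, z)) y) y := by
  obtain ⟨K, hK, hyK, hKU⟩ := exists_compact_subset hU hy
  have hcont : ContinuousOn (fun q : ℝ × X => fderiv ℝ (fun z => g (q.1, z)) q.2)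
      (Set.uIcc a b ×ˢ K) := fun q hq =>
    (ContDiffAt.fderiv_slice (hg q.1 q.2 (hKU hq.2))).continuousAt.continuousWithinAt
  obtain ⟨B, hB⟩ := (isCompact_uIcc.prod hK).exists_bound_of_continuousOn hcont
  have hslice : ∀ z ∈ U, Continuous fun s => g (s, z) := fun z hz =>
    continuous_slice_of_contDiffAt fun s => hg s z hz
  refine intervalIntegral.hasFDerivAt_integral_of_dominated_of_fderiv_le
    (F := fun z s => g (s, z)) (F' := fun z s => fderiv ℝ (fun z => g (s, z)) z)
    (bound := fun _ => B) (s := K)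
    (mem_interior_iff_mem_nhds.1 hyK) ?_ ((hslice y hy).intervalIntegrable _ _) ?_ ?_
    intervalIntegrable_const ?_
  · filter_upwards [hU.mem_nhds hy] with z hz using (hslice z hz).aestronglyMeasurable
  · exact (continuous_slice_of_contDiffAt
      (fun s => ContDiffAt.fderiv_slice (hg s y hy))).aestronglyMeasurable
  · exact Filter.Eventually.of_forall fun t ht z hz => hB (t, z) ⟨Set.uIoc_subset_uIcc ht, hz⟩
  · refine Filter.Eventually.of_forall fun t _ z hz => DifferentiableAt.hasFDerivAt ?_
    exact ((hg t z (hKU hz)).differentiableAt (by simp)).comp (f := fun z => (t, z)) z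
      (hasFDerivAt_prodMk_right t z).differentiableAt

/-- The integral over a compact interval of a smooth family of functions is smooth. Domain and
codomain lie in one universe, so that the codomain can be replaced by `X →L[ℝ] F` in the
induction on the order of differentiability. -/
theorem contDiffOn_integral.{u} {X : Type u} [NormedAddCommGroup X] [NormedSpace ℝ X]
    [FiniteDimensional ℝ X] {U : Set X} (hU : IsOpen U) (a b : ℝ) :
    ∀ {F : Type u} [NormedAddCommGroup F] [NormedSpace ℝ F] [CompleteSpace F] {g : ℝ × X → F},
      (∀ s, ∀ y ∈ U, ContDiffAt ℝ ∞ g (s, y)) →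
      ContDiffOn ℝ ∞ (fun y => ∫ s in a..b, g (s, y)) U := by
  suffices H : ∀ (m : ℕ) {F : Type u} [NormedAddCommGroup F] [NormedSpace ℝ F] [CompleteSpace F]
      {g : ℝ × X → F}, (∀ s, ∀ y ∈ U, ContDiffAt ℝ ∞ g (s, y)) →
      ContDiffOn ℝ m (fun y => ∫ s in a..b, g (s, y)) U from
    fun {F} _ _ _ {g} hg => contDiffOn_infty.2 fun m => H m hg
  intro m
  induction m with
  | zero =>
    intro F _ _ _ g hg
    exact contDiffOn_zero.2 fun y hy =>
      (hasFDerivAt_integral_of_contDiffAt hU hg a b hy).continuousAt.continuousWithinAt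
  | succ m ih =>
    intro F _ _ _ g hg
    push_cast
    refine (contDiffOn_succ_iff_hasFDerivWithinAt_of_uniqueDiffOn hU.uniqueDiffOn).2
      ⟨by simp, fun y => ∫ s in a..b, fderiv ℝ (fun z => g (s, z)) y, ?_, fun y hy =>
        (hasFDerivAt_integral_of_contDiffAt hU hg a b hy).hasFDerivWithinAt⟩
    exact ih (g := fun q : ℝ × X => fderiv ℝ (fun z => g (q.1, z)) q.2)
      fun s y hy => ContDiffAt.fderiv_slice (hg s y hy)

/-- Cartan's formula on `ℝ × X` for the vector field `∂/∂s`, restricted to a slice: for a form `η`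
of positive degree, the `s`-derivative of its restriction to `{s} × X` is
`d (ι_{∂/∂s} η) + ι_{∂/∂s} (dη)`. -/
theorem extDeriv_slice_add {k : ℕ} {η : ℝ × X → (ℝ × X) [⋀^Fin (k + 1)]→L[ℝ] ℝ} {s : ℝ} {y : X}
    (hη : DifferentiableAt ℝ η (s, y)) :
    extDeriv (fun z => ((η (s, z)).curryLeft (1, 0)).compContinuousLinearMap
        (ContinuousLinearMap.inr ℝ ℝ X)) y
      + ((extDeriv η (s, y)).curryLeft (1, 0)).compContinuousLinearMap
        (ContinuousLinearMap.inr ℝ ℝ X)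
      = deriv (fun t => (η (t, y)).compContinuousLinearMap (ContinuousLinearMap.inr ℝ ℝ X)) s := by
  have hy : HasFDerivAt (fun z : X => η (s, z)) ((fderiv ℝ η (s, y)).comp
      (ContinuousLinearMap.inr ℝ ℝ X)) y :=
    hη.hasFDerivAt.comp y (hasFDerivAt_prodMk_right s y)
  have hs : HasDerivAt (fun t => η (t, y)) (fderiv ℝ η (s, y) (1, 0)) s :=
    hη.hasFDerivAt.comp_hasDerivAt s ((hasDerivAt_id s).prodMk (hasDerivAt_const s y))
  have hs' := ((compContinuousLinearMapCLM (F := ℝ) (ι := Fin (k + 1))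
    (ContinuousLinearMap.inr ℝ ℝ X)).hasFDerivAt.comp_hasDerivAt s hs).deriv
  have hy' := ((compContinuousLinearMapCLM (F := ℝ) (ι := Fin k)
    (ContinuousLinearMap.inr ℝ ℝ X)).hasFDerivAt.comp y
      (((ContinuousLinearMap.apply ℝ ((ℝ × X) [⋀^Fin k]→L[ℝ] ℝ) ((1, 0) : ℝ × X)).comp
        (curryLeftLI (𝕜 := ℝ) (E := ℝ × X) (F := ℝ)
          (n := k)).toContinuousLinearMap).hasFDerivAt.comp y hy)).fderiv
  refine Eq.trans ?_ hs'.symm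
  have e1 : extDeriv (fun z => ((η (s, z)).curryLeft (1, 0)).compContinuousLinearMap
        (ContinuousLinearMap.inr ℝ ℝ X)) y = _ := congrArg alternatizeUncurryFin hy'
  rw [e1]
  ext v
  have hrem : ∀ (i : Fin (k + 1)) (w : Fin (k + 1) → ℝ × X),
      i.succ.removeNth (α := fun _ => ℝ × X) (Matrix.vecCons (1, 0) w)
        = Matrix.vecCons (1, 0) (i.removeNth w) := by
    intro i w
    ext1 j
    refine Fin.cases ?_ (fun j => ?_) j <;> simp [Fin.removeNth]
  simp only [extDeriv, ContinuousAlternatingMap.add_apply, alternatizeUncurryFin_apply,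
    compContinuousLinearMap_apply, curryLeft_apply_apply]
  -- The first summand of `dη (∂/∂s, v)` is the `s`-derivative; the others cancel `d (ι η) (v)`.
  rw [Fin.sum_univ_succ (n := k + 1), add_left_comm, ← Finset.sum_add_distrib,
    Finset.sum_eq_zero, add_zero]
  · simp [Function.comp_def]
  · intro i _
    simp only [hrem]
    simp [Function.comp_def, pow_succ, Fin.removeNth]
    exact add_neg_cancel _

/-- The case of degree zero of `extDeriv_slice_add`. -/
theorem extDeriv_slice_zero {η : ℝ × X → (ℝ × X) [⋀^Fin 0]→L[ℝ] ℝ} {s : ℝ} {y : X}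
    (hη : DifferentiableAt ℝ η (s, y)) :
    ((extDeriv η (s, y)).curryLeft (1, 0)).compContinuousLinearMap
        (ContinuousLinearMap.inr ℝ ℝ X)
      = deriv (fun t => (η (t, y)).compContinuousLinearMap (ContinuousLinearMap.inr ℝ ℝ X)) s := by
  have hs : HasDerivAt (fun t => η (t, y)) (fderiv ℝ η (s, y) (1, 0)) s :=
    hη.hasFDerivAt.comp_hasDerivAt s ((hasDerivAt_id s).prodMk (hasDerivAt_const s y))
  have hs' := ((compContinuousLinearMapCLM (F := ℝ) (ι := Fin 0)
    (ContinuousLinearMap.inr ℝ ℝ X)).hasFDerivAt.comp_hasDerivAt s hs).deriv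
  refine Eq.trans ?_ hs'.symm
  ext v
  simp [extDeriv, alternatizeUncurryFin_apply, Function.comp_def]

end Calculus

/-! ### Pullback of forms to vector spaces -/

section Derivative

variable {E' : Type*} [NormedAddCommGroup E'] [NormedSpace ℝ E']
  {N : Type*} [TopologicalSpace N] [ChartedSpace E' N]
  {E : Type*} [NormedAddCommGroup E] [NormedSpace ℝ E]
  {M : Type*} [TopologicalSpace M] [ChartedSpace E M]
  {E'' : Type*} [NormedAddCommGroup E''] [NormedSpace ℝ E'']
  {N' : Type*} [TopologicalSpace N'] [ChartedSpace E'' N']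

variable (E' E) in
/-- The derivative of a map between manifolds, with all tangent spaces identified with the model
spaces. -/
def mderiv (f : N → M) (p : N) : E' →L[ℝ] E := mfderiv 𝓘(ℝ, E') 𝓘(ℝ, E) f p

theorem mderiv_comp {f : N → M} {g : N' → N} {p : N'} {q : N} (hq : g p = q)
    (hf : MDifferentiableAt 𝓘(ℝ, E') 𝓘(ℝ, E) f q)
    (hg : MDifferentiableAt 𝓘(ℝ, E'') 𝓘(ℝ, E') g p) :
    mderiv E'' E (fun z => f (g z)) p = (mderiv E' E f q).comp (mderiv E'' E' g p) := by
  subst hq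
  exact mfderiv_comp p hf hg

theorem mderiv_eq_fderiv (f : E' → E) (w : E') : mderiv E' E f w = fderiv ℝ f w :=
  mfderiv_eq_fderiv

theorem mderiv_congr {f g : N → M} {p : N} (h : f =ᶠ[𝓝 p] g) : mderiv E' E f p = mderiv E' E g p :=
  h.mfderiv_eq

end Derivative

section PullbackVec

variable {E : Type*} [NormedAddCommGroup E] [NormedSpace ℝ E]
  {M : Type*} [TopologicalSpace M] [ChartedSpace E M]
  {W : Type*} [NormedAddCommGroup W] [NormedSpace ℝ W]

/-- The pullback of a `k`-form on `M` by a map `f` from a normed space `W`, as a form on `W`. For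
`f` the inverse of a chart this is `formInChart`. -/
def pullbackVec {k : ℕ} (f : W → M)
    (β : ∀ p : M, (TangentSpace 𝓘(ℝ, E) p) [⋀^Fin k]→L[ℝ] ℝ) : W → W [⋀^Fin k]→L[ℝ] ℝ :=
  fun w => (β (f w)).compContinuousLinearMap (mfderiv 𝓘(ℝ, W) 𝓘(ℝ, E) f w)

/-- The field `β` with all tangent spaces identified with the model space `E`. -/
def asField {k : ℕ} (β : ∀ p : M, (TangentSpace 𝓘(ℝ, E) p) [⋀^Fin k]→L[ℝ] ℝ) :
    M → E [⋀^Fin k]→L[ℝ] ℝ := β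

variable [IsManifold 𝓘(ℝ, E) ∞ M]

theorem contMDiffAt_extChartAt_symm {q : M} {y : E} (hy : y ∈ (extChartAt 𝓘(ℝ, E) q).target) :
    ContMDiffAt 𝓘(ℝ, E) 𝓘(ℝ, E) ∞ (extChartAt 𝓘(ℝ, E) q).symm y :=
  (contMDiffOn_extChartAt_symm q).contMDiffAt ((isOpen_extChartAt_target q).mem_nhds hy)

theorem mdifferentiableAt_extChartAt_symm {q : M} {y : E}
    (hy : y ∈ (extChartAt 𝓘(ℝ, E) q).target) :
    MDifferentiableAt 𝓘(ℝ, E) 𝓘(ℝ, E) (extChartAt 𝓘(ℝ, E) q).symm y :=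
  (contMDiffAt_extChartAt_symm hy).mdifferentiableAt (by simp)

/-- The chain rule for `f = φ⁻¹ ∘ (φ ∘ f)`, where `φ` is the preferred chart around `q`. -/
theorem mderiv_eq_symm_comp_fderiv {f : W → M} {w : W} {q : M}
    (hf : MDifferentiableAt 𝓘(ℝ, W) 𝓘(ℝ, E) f w)
    (hq : f w ∈ (extChartAt 𝓘(ℝ, E) q).source) :
    mderiv W E f w = (mderiv E E (extChartAt 𝓘(ℝ, E) q).symm (extChartAt 𝓘(ℝ, E) q (f w))).comp
      (fderiv ℝ (extChartAt 𝓘(ℝ, E) q ∘ f) w) := by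
  have : IsManifold 𝓘(ℝ, E) 1 M := .of_le (n := ∞) (by simp)
  have hφ : MDifferentiableAt 𝓘(ℝ, E) 𝓘(ℝ, E) (extChartAt 𝓘(ℝ, E) q) (f w) :=
    mdifferentiableAt_extChartAt (by rwa [extChartAt_source] at hq)
  have h1 : (extChartAt 𝓘(ℝ, E) q).symm ∘ (extChartAt 𝓘(ℝ, E) q ∘ f) =ᶠ[𝓝 w] f := by
    filter_upwards [hf.continuousAt ((isOpen_extChartAt_source q).mem_nhds hq)] with z hz
    exact (extChartAt 𝓘(ℝ, E) q).left_inv hz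
  rw [← mderiv_eq_fderiv, ← mderiv_congr h1]
  exact mderiv_comp (g := extChartAt 𝓘(ℝ, E) q ∘ f) rfl (mdifferentiableAt_extChartAt_symm
    ((extChartAt 𝓘(ℝ, E) q).map_source hq)) (hφ.comp w hf)

/-- The pullback by `f` is the pullback of a local representative by `f` read in the chart. This
reduces statements on `pullbackVec` to calculus in vector spaces. -/
theorem pullbackVec_eq_formInChart {k : ℕ} {f : W → M} {w : W} {q : M}
    (β : ∀ p : M, (TangentSpace 𝓘(ℝ, E) p) [⋀^Fin k]→L[ℝ] ℝ)
    (hf : MDifferentiableAt 𝓘(ℝ, W) 𝓘(ℝ, E) f w)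
    (hq : f w ∈ (extChartAt 𝓘(ℝ, E) q).source) :
    pullbackVec f β w = (formInChart β q (extChartAt 𝓘(ℝ, E) q (f w))).compContinuousLinearMap
      (fderiv ℝ (extChartAt 𝓘(ℝ, E) q ∘ f) w) := by
  have h := congrArg (asField β)
    ((extChartAt 𝓘(ℝ, E) q).left_inv hq)
  have h2 := congrArg₂ (fun (b : E [⋀^Fin k]→L[ℝ] ℝ) (L : W →L[ℝ] E) =>
    b.compContinuousLinearMap L) h.symm (mderiv_eq_symm_comp_fderiv hf hq)
  exact h2

theorem pullbackVec_eventuallyEq {k : ℕ} {f : W → M} {w : W} (q : M)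
    (β : ∀ p : M, (TangentSpace 𝓘(ℝ, E) p) [⋀^Fin k]→L[ℝ] ℝ)
    (hf : ContMDiffAt 𝓘(ℝ, W) 𝓘(ℝ, E) ∞ f w)
    (hq : f w ∈ (extChartAt 𝓘(ℝ, E) q).source) :
    pullbackVec f β =ᶠ[𝓝 w] fun z =>
      (formInChart β q ((extChartAt 𝓘(ℝ, E) q ∘ f) z)).compContinuousLinearMap
        (fderiv ℝ (extChartAt 𝓘(ℝ, E) q ∘ f) z) := by
  have : IsManifold 𝓘(ℝ, E) 1 M := .of_le (n := ∞) (by simp)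
  have h1 : ContMDiffAt 𝓘(ℝ, W) 𝓘(ℝ, E) 1 f w := hf.of_le (by simp)
  filter_upwards [(contMDiffAt_iff_contMDiffAt_nhds (by simp)).1 h1,
    hf.continuousAt ((isOpen_extChartAt_source q).mem_nhds hq)] with z hz hz'
  exact pullbackVec_eq_formInChart β (hz.mdifferentiableAt (by simp)) hz'

theorem contDiffAt_extChartAt_comp {f : W → M} {w : W} {q : M}
    (hf : ContMDiffAt 𝓘(ℝ, W) 𝓘(ℝ, E) ∞ f w)
    (hq : f w ∈ (extChartAt 𝓘(ℝ, E) q).source) :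
    ContDiffAt ℝ ∞ (extChartAt 𝓘(ℝ, E) q ∘ f) w :=
  contMDiffAt_iff_contDiffAt.1
    ((contMDiffAt_extChartAt' (by rwa [extChartAt_source] at hq)).comp w hf)

omit [IsManifold 𝓘(ℝ, E) ∞ M] in
theorem IsSmoothForm.contDiffAt_formInChart {β : GradedForm E M} (hβ : IsSmoothForm β) (k : ℕ)
    (q : M) {y : E} (hy : y ∈ (extChartAt 𝓘(ℝ, E) q).target) :
    ContDiffAt ℝ ∞ (formInChart (β k) q) y :=
  (hβ k q).contDiffAt ((isOpen_extChartAt_target q).mem_nhds hy)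

theorem IsSmoothForm.contDiffAt_pullbackVec {β : GradedForm E M} (hβ : IsSmoothForm β) (k : ℕ)
    {f : W → M} {w : W} (hf : ContMDiffAt 𝓘(ℝ, W) 𝓘(ℝ, E) ∞ f w) :
    ContDiffAt ℝ ∞ (pullbackVec f (β k)) w := by
  have hq := mem_extChartAt_source (I := 𝓘(ℝ, E)) (f w)
  have hc := contDiffAt_extChartAt_comp hf hq
  refine ContDiffAt.congr_of_eventuallyEq ?_ (pullbackVec_eventuallyEq (f w) (β k) hf hq)
  refine ContDiffAt.compContinuousLinearMap ?_ (hc.fderiv_right (m := ∞) (by simp))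
  exact (hβ.contDiffAt_formInChart k (f w) (mem_extChartAt_target (f w))).comp w hc

/-- The exterior derivative commutes with pullback to vector spaces. In particular it may be
computed in any chart, not only in the preferred one. -/
theorem IsSmoothForm.extDeriv_pullbackVec {β : GradedForm E M} (hβ : IsSmoothForm β) (k : ℕ)
    {f : W → M} {w : W} (hf : ContMDiffAt 𝓘(ℝ, W) 𝓘(ℝ, E) ∞ f w) :
    extDeriv (pullbackVec f (β k)) w = pullbackVec f (extDerivForm (β k)) w := by
  have : IsManifold 𝓘(ℝ, E) 1 M := .of_le (n := ∞) (by simp)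
  have hq := mem_extChartAt_source (I := 𝓘(ℝ, E)) (f w)
  have hc := contDiffAt_extChartAt_comp hf hq
  have hb : DifferentiableAt ℝ (formInChart (β k) (f w)) ((extChartAt 𝓘(ℝ, E) (f w) ∘ f) w) :=
    (hβ.contDiffAt_formInChart k (f w) (mem_extChartAt_target (f w))).differentiableAt (by simp)
  rw [(pullbackVec_eventuallyEq (f w) (β k) hf hq).extDeriv_eq,
    extDeriv_pullback hb hc (by simp; exact WithTop.coe_le_coe.2 (le_top : (2 : ℕ∞) ≤ ⊤))]
  have h1 : fderiv ℝ (extChartAt 𝓘(ℝ, E) (f w) ∘ f) w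
      = (mderiv E E (extChartAt 𝓘(ℝ, E) (f w)) (f w)).comp (mderiv W E f w) := by
    rw [← mderiv_eq_fderiv]
    exact mderiv_comp rfl (mdifferentiableAt_extChartAt (mem_chart_source _ _))
      (hf.mdifferentiableAt (by simp))
  rw [h1]
  rfl

theorem IsSmoothForm.deRham {β : GradedForm E M} (hβ : IsSmoothForm β) :
    IsSmoothForm (deRham β) := by
  rintro (_ | k) p
  · have h0 : formInChart (EquivForms.deRham β 0) p = fun _ => 0 := by
      funext y; ext v; rfl
    rw [h0]
    exact contDiffOn_const
  · have hopen := isOpen_extChartAt_target (I := 𝓘(ℝ, E)) p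
    have h1 : ContDiffOn ℝ ∞ (extDeriv (formInChart (β k) p)) (extChartAt 𝓘(ℝ, E) p).target :=
      (ContinuousAlternatingMap.alternatizeUncurryFinCLM ℝ E ℝ).contDiff.comp_contDiffOn
        ((hβ k p).fderiv_of_isOpen hopen (by simp))
    exact h1.congr fun y hy =>
      (hβ.extDeriv_pullbackVec k (contMDiffAt_extChartAt_symm hy)).symm

/-- A form is determined at `p` by its local representative in the preferred chart around `p`. -/
theorem eq_formInChart_comp {k : ℕ} (β : ∀ p : M, (TangentSpace 𝓘(ℝ, E) p) [⋀^Fin k]→L[ℝ] ℝ)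
    (p : M) : β p = (formInChart β p (extChartAt 𝓘(ℝ, E) p p)).compContinuousLinearMap
      (mfderiv 𝓘(ℝ, E) 𝓘(ℝ, E) (extChartAt 𝓘(ℝ, E) p) p) := by
  have : IsManifold 𝓘(ℝ, E) 1 M := .of_le (n := ∞) (by simp)
  have h := mfderivWithin_extChartAt_symm_comp_mfderiv_extChartAt' (I := 𝓘(ℝ, E))
    (mem_extChartAt_source (I := 𝓘(ℝ, E)) p)
  rw [modelWithCornersSelf_coe, Set.range_id, mfderivWithin_univ] at h
  have h1 := congrArg (asField β)
    ((extChartAt 𝓘(ℝ, E) p).left_inv (mem_extChartAt_source (I := 𝓘(ℝ, E)) p))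
  exact (congrArg₂ (fun (b : E [⋀^Fin k]→L[ℝ] ℝ) (L : E →L[ℝ] E) =>
    b.compContinuousLinearMap L) h1 h).symm

end PullbackVec

/-! ### The homotopy operator -/

section Homotopy

open ContinuousAlternatingMap

variable {E : Type*} [NormedAddCommGroup E] [NormedSpace ℝ E]
  {M : Type*} [TopologicalSpace M] [ChartedSpace E M]

/-- The velocity `∂H/∂s (s, p)` of a family of maps `H s`. -/
def velocity (H : ℝ → M → M) (s : ℝ) (p : M) : E := mderiv ℝ E (fun t => H t p) s 1

/-- The `k`-form `ι_{∂/∂s} (H^* β)` on the slice `{s} × M`, at the point `p`. -/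
def homotopyIntegrand (H : ℝ → M → M) (β : GradedForm E M) (k : ℕ) (s : ℝ) (p : M) :
    E [⋀^Fin k]→L[ℝ] ℝ :=
  ((asField (β (k + 1)) (H s p)).curryLeft (velocity H s p)).compContinuousLinearMap
    (mderiv E E (H s) p)

/-- The homotopy operator `β ↦ ∫₀¹ ι_{∂/∂s} (H^* β) ds` of a family of maps `H s`. -/
def homotopyOperator (H : ℝ → M → M) (β : GradedForm E M) : GradedForm E M := fun k p =>
  (∫ s in (0 : ℝ)..1, homotopyIntegrand H β k s p : E [⋀^Fin k]→L[ℝ] ℝ)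

/-- The family `H` precomposed with the inverse of the preferred chart around `p`. -/
def chartHomotopy (E : Type*) [NormedAddCommGroup E] [NormedSpace ℝ E] [ChartedSpace E M]
    (H : ℝ → M → M) (p : M) (q : ℝ × E) : M :=
  H q.1 ((extChartAt 𝓘(ℝ, E) p).symm q.2)

/-- For a form `η` on `ℝ × E`, the map `η ↦ ι_{∂/∂s} η` followed by restriction to slices. -/
def sliceContract (E : Type*) [NormedAddCommGroup E] [NormedSpace ℝ E] (k : ℕ) :
    (ℝ × E) [⋀^Fin (k + 1)]→L[ℝ] ℝ →L[ℝ] E [⋀^Fin k]→L[ℝ] ℝ :=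
  (compContinuousLinearMapCLM (ContinuousLinearMap.inr ℝ ℝ E)).comp
    ((ContinuousLinearMap.apply ℝ ((ℝ × E) [⋀^Fin k]→L[ℝ] ℝ) ((1, 0) : ℝ × E)).comp
        (curryLeftLI (𝕜 := ℝ) (E := ℝ × E) (F := ℝ) (n := k)).toContinuousLinearMap)

theorem IsHomogeneousForm.homotopyOperator {H : ℝ → M → M} {β : GradedForm E M} {j : ℤ}
    (hβ : IsHomogeneousForm j β) : IsHomogeneousForm (j - 1) (homotopyOperator H β) := by
  intro k hk
  have h0 : β (k + 1) = 0 := hβ (k + 1) (by push_cast; omega)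
  have h1 : ∀ s p, homotopyIntegrand H β k s p = 0 := by
    intro s p
    rw [homotopyIntegrand, h0]
    rfl
  funext p
  have h2 : ∫ s in (0 : ℝ)..1, homotopyIntegrand H β k s p = 0 := by simp [h1]
  exact h2

variable [IsManifold 𝓘(ℝ, E) ∞ M] {H : ℝ → M → M}
  (hH : ContMDiff (𝓘(ℝ, ℝ).prod 𝓘(ℝ, E)) 𝓘(ℝ, E) ∞ (fun q : ℝ × M => H q.1 q.2))

include hH

omit [IsManifold 𝓘(ℝ, E) ∞ M] in
theorem contMDiff_slice (s : ℝ) : ContMDiff 𝓘(ℝ, E) 𝓘(ℝ, E) ∞ (H s) :=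
  hH.comp (contMDiff_const.prodMk contMDiff_id)

omit [IsManifold 𝓘(ℝ, E) ∞ M] in
theorem contMDiff_curve (p : M) : ContMDiff 𝓘(ℝ, ℝ) 𝓘(ℝ, E) ∞ (fun s => H s p) :=
  hH.comp (contMDiff_id.prodMk contMDiff_const)

theorem contMDiffAt_chartHomotopy (p : M) (s : ℝ) {y : E}
    (hy : y ∈ (extChartAt 𝓘(ℝ, E) p).target) :
    ContMDiffAt 𝓘(ℝ, ℝ × E) 𝓘(ℝ, E) ∞ (chartHomotopy E H p) (s, y) := by
  have h1 : ContMDiffAt 𝓘(ℝ, ℝ × E) 𝓘(ℝ, ℝ) ∞ (Prod.fst : ℝ × E → ℝ) (s, y) :=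
    contDiffAt_fst.contMDiffAt
  have h2 : ContMDiffAt 𝓘(ℝ, ℝ × E) 𝓘(ℝ, E) ∞ (Prod.snd : ℝ × E → E) (s, y) :=
    contDiffAt_snd.contMDiffAt
  exact hH.contMDiffAt.comp (s, y)
    (h1.prodMk ((contMDiffAt_extChartAt_symm hy).comp (s, y) h2))

theorem mderiv_chartHomotopy_time (p : M) (s : ℝ) {y : E}
    (hy : y ∈ (extChartAt 𝓘(ℝ, E) p).target) :
    mderiv (ℝ × E) E (chartHomotopy E H p) (s, y) (1, 0)
      = velocity H s ((extChartAt 𝓘(ℝ, E) p).symm y) := by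
  have h1 : HasFDerivAt (fun t : ℝ => (t, y)) (ContinuousLinearMap.inl ℝ ℝ E) s :=
    hasFDerivAt_prodMk_left s y
  have h := mderiv_comp (E := E) (f := chartHomotopy E H p) (g := fun t : ℝ => (t, y)) (p := s) rfl
    ((contMDiffAt_chartHomotopy hH p s hy).mdifferentiableAt (by simp))
    h1.differentiableAt.mdifferentiableAt
  rw [mderiv_eq_fderiv, h1.fderiv] at h
  exact (congrArg (fun L : ℝ →L[ℝ] E => L 1) h).symm

theorem mderiv_chartHomotopy_space (p : M) (s : ℝ) {y : E}
    (hy : y ∈ (extChartAt 𝓘(ℝ, E) p).target) :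
    (mderiv (ℝ × E) E (chartHomotopy E H p) (s, y)).comp (ContinuousLinearMap.inr ℝ ℝ E)
      = (mderiv E E (H s) ((extChartAt 𝓘(ℝ, E) p).symm y)).comp
        (mderiv E E (extChartAt 𝓘(ℝ, E) p).symm y) := by
  have h1 : HasFDerivAt (fun z : E => (s, z)) (ContinuousLinearMap.inr ℝ ℝ E) y :=
    hasFDerivAt_prodMk_right s y
  have h := mderiv_comp (E := E) (f := chartHomotopy E H p) (g := fun z : E => (s, z)) (p := y) rfl
    ((contMDiffAt_chartHomotopy hH p s hy).mdifferentiableAt (by simp))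
    h1.differentiableAt.mdifferentiableAt
  rw [mderiv_eq_fderiv, h1.fderiv] at h
  refine h.symm.trans ?_
  exact mderiv_comp (f := H s) (g := (extChartAt 𝓘(ℝ, E) p).symm) rfl
    ((contMDiff_slice hH s).mdifferentiableAt (by simp)) (mdifferentiableAt_extChartAt_symm hy)

/-- In a chart, the integrand of the homotopy operator is `ι_{∂/∂s}` of the pullback of `β` to
`ℝ × E`. -/
theorem sliceContract_pullbackVec (β : GradedForm E M) (k : ℕ) (p : M) (s : ℝ) {y : E}
    (hy : y ∈ (extChartAt 𝓘(ℝ, E) p).target) :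
    sliceContract E k (pullbackVec (chartHomotopy E H p) (β (k + 1)) (s, y))
      = (homotopyIntegrand H β k s ((extChartAt 𝓘(ℝ, E) p).symm y)).compContinuousLinearMap
        (mderiv E E (extChartAt 𝓘(ℝ, E) p).symm y) := by
  have h1 := mderiv_chartHomotopy_time hH p s hy
  have h2 := mderiv_chartHomotopy_space hH p s hy
  ext v
  have h3 : ∀ u : E, mderiv (ℝ × E) E (chartHomotopy E H p) (s, y) (0, u)
      = mderiv E E (H s) ((extChartAt 𝓘(ℝ, E) p).symm y)
        (mderiv E E (extChartAt 𝓘(ℝ, E) p).symm y u) := fun u =>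
    congrArg (fun L : E →L[ℝ] E => L u) h2
  change asField (β (k + 1)) (H s ((extChartAt 𝓘(ℝ, E) p).symm y))
      (mderiv (ℝ × E) E (chartHomotopy E H p) (s, y) ∘
        Matrix.vecCons ((1, 0) : ℝ × E) fun i => ((0, v i) : ℝ × E))
    = asField (β (k + 1)) (H s ((extChartAt 𝓘(ℝ, E) p).symm y))
      (Matrix.vecCons (velocity H s ((extChartAt 𝓘(ℝ, E) p).symm y)) fun i =>
        mderiv E E (H s) ((extChartAt 𝓘(ℝ, E) p).symm y)
          (mderiv E E (extChartAt 𝓘(ℝ, E) p).symm y (v i)))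
  congr 1
  funext i
  refine Fin.cases ?_ (fun i => ?_) i
  · exact h1
  · exact h3 (v i)

theorem slice_pullbackVec (β : GradedForm E M) (k : ℕ) (p : M) (s : ℝ) {y : E}
    (hy : y ∈ (extChartAt 𝓘(ℝ, E) p).target) :
    (pullbackVec (chartHomotopy E H p) (β k) (s, y)).compContinuousLinearMap
        (ContinuousLinearMap.inr ℝ ℝ E)
      = formInChart (pullback (H s) β k) p y :=
  congrArg (fun L : E →L[ℝ] E => (asField (β k)
    (H s ((extChartAt 𝓘(ℝ, E) p).symm y))).compContinuousLinearMap L)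
    (mderiv_chartHomotopy_space hH p s hy)

variable {β : GradedForm E M} (hβ : IsSmoothForm β)
include hβ

theorem contDiffAt_sliceContract (k : ℕ) (p : M) (s : ℝ) {y : E}
    (hy : y ∈ (extChartAt 𝓘(ℝ, E) p).target) :
    ContDiffAt ℝ ∞ (fun q => sliceContract E k
      (pullbackVec (chartHomotopy E H p) (β (k + 1)) q)) (s, y) :=
  (sliceContract E k).contDiff.contDiffAt.comp (s, y)
    (hβ.contDiffAt_pullbackVec (k + 1) (contMDiffAt_chartHomotopy hH p s hy))

theorem continuous_homotopyIntegrand (k : ℕ) (p : M) :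
    Continuous fun s => homotopyIntegrand H β k s p := by
  have hy := mem_extChartAt_target (I := 𝓘(ℝ, E)) p
  have h1 : Continuous fun s => sliceContract E k
      (pullbackVec (chartHomotopy E H p) (β (k + 1)) (s, extChartAt 𝓘(ℝ, E) p p)) :=
    continuous_slice_of_contDiffAt fun s => contDiffAt_sliceContract hH hβ k p s hy
  have h2 := (compContinuousLinearMapCLM (F := ℝ) (ι := Fin k)
    (mderiv E E (extChartAt 𝓘(ℝ, E) p) p)).continuous.comp h1
  refine h2.congr fun s => ?_
  simp only [Function.comp_apply, sliceContract_pullbackVec hH β k p s hy]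
  exact (eq_formInChart_comp (k := k) (fun x => homotopyIntegrand H β k s x) p).symm

theorem formInChart_homotopyOperator [FiniteDimensional ℝ E] (k : ℕ) (p : M) {y : E}
    (hy : y ∈ (extChartAt 𝓘(ℝ, E) p).target) :
    formInChart (homotopyOperator H β k) p y = ∫ s in (0 : ℝ)..1, sliceContract E k
      (pullbackVec (chartHomotopy E H p) (β (k + 1)) (s, y)) := by
  simp only [sliceContract_pullbackVec hH β k p _ hy]
  exact ((compContinuousLinearMapCLM (F := ℝ) (ι := Fin k)
    (mderiv E E (extChartAt 𝓘(ℝ, E) p).symm y)).intervalIntegral_comp_comm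
    ((continuous_homotopyIntegrand hH hβ k _).intervalIntegrable 0 1)).symm

theorem isSmoothForm_homotopyOperator [FiniteDimensional ℝ E] :
    IsSmoothForm (homotopyOperator H β) := fun k p =>
  (contDiffOn_integral (isOpen_extChartAt_target p) 0 1 fun s _ hy =>
    contDiffAt_sliceContract hH hβ k p s hy).congr fun _ hy =>
      formInChart_homotopyOperator hH hβ k p hy

/-- The fundamental theorem of calculus for the family of pullbacks `(H s)^* β`, seen in a chart. -/
theorem integral_deriv_slice [FiniteDimensional ℝ E] (k : ℕ) (p : M) {y : E}
    (hy : y ∈ (extChartAt 𝓘(ℝ, E) p).target) :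
    ∫ s in (0 : ℝ)..1, deriv (fun t => (pullbackVec (chartHomotopy E H p) (β k)
        (t, y)).compContinuousLinearMap (ContinuousLinearMap.inr ℝ ℝ E)) s
      = formInChart (pullback (H 1) β k) p y - formInChart (pullback (H 0) β k) p y := by
  have hc : ContDiff ℝ ∞ (fun t : ℝ => (pullbackVec (chartHomotopy E H p) (β k)
        (t, y)).compContinuousLinearMap (ContinuousLinearMap.inr ℝ ℝ E)) :=
    contDiff_iff_contDiffAt.2 fun t =>
      (compContinuousLinearMapCLM (F := ℝ) (ι := Fin k)
        (ContinuousLinearMap.inr ℝ ℝ E)).contDiff.contDiffAt.comp t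
        ((hβ.contDiffAt_pullbackVec k (contMDiffAt_chartHomotopy hH p t hy)).comp t
          (f := fun t : ℝ => (t, y)) (contDiffAt_id.prodMk contDiffAt_const))
  rw [intervalIntegral.integral_eq_sub_of_hasDerivAt
    (fun t _ => ((hc.differentiable (by simp)) t).hasDerivAt)
    ((hc.continuous_deriv (by simp)).intervalIntegrable 0 1),
    slice_pullbackVec hH β k p 1 hy, slice_pullbackVec hH β k p 0 hy]

-- The norm on `E →L[ℝ] E [⋀^Fin k]→L[ℝ] ℝ` is not found at the default instance depth.
set_option maxSynthPendingDepth 3 in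
/-- The exterior derivative of the homotopy operator is taken under the integral sign. -/
theorem extDeriv_formInChart_homotopyOperator [FiniteDimensional ℝ E] (k : ℕ) (p : M) {y : E}
    (hy : y ∈ (extChartAt 𝓘(ℝ, E) p).target) :
    extDeriv (formInChart (homotopyOperator H β k) p) y = ∫ s in (0 : ℝ)..1,
      extDeriv (fun z => sliceContract E k
        (pullbackVec (chartHomotopy E H p) (β (k + 1)) (s, z))) y := by
  have hopen := isOpen_extChartAt_target (I := 𝓘(ℝ, E)) p
  have h1 : formInChart (homotopyOperator H β k) p =ᶠ[𝓝 y] fun z => ∫ s in (0 : ℝ)..1,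
      sliceContract E k (pullbackVec (chartHomotopy E H p) (β (k + 1)) (s, z)) := by
    filter_upwards [hopen.mem_nhds hy] with z hz using formInChart_homotopyOperator hH hβ k p hz
  have hg := fun (s : ℝ) (z : E) (hz : z ∈ (extChartAt 𝓘(ℝ, E) p).target) =>
    contDiffAt_sliceContract hH hβ k p s hz
  have hint : IntervalIntegrable (fun s => fderiv ℝ (fun z => sliceContract E k
      (pullbackVec (chartHomotopy E H p) (β (k + 1)) (s, z))) y) MeasureTheory.volume 0 1 :=
    Continuous.intervalIntegrable (continuous_slice_of_contDiffAt fun s =>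
      ContDiffAt.fderiv_slice (hg s y hy)) 0 1
  rw [h1.extDeriv_eq, extDeriv, (hasFDerivAt_integral_of_contDiffAt hopen hg 0 1 hy).fderiv]
  exact ((alternatizeUncurryFinCLM ℝ E ℝ).intervalIntegral_comp_comm
    hint).symm

theorem formInChart_homotopyOperator_deRham [FiniteDimensional ℝ E] (k : ℕ) (p : M) {y : E}
    (hy : y ∈ (extChartAt 𝓘(ℝ, E) p).target) :
    formInChart (homotopyOperator H (deRham β) k) p y = ∫ s in (0 : ℝ)..1, sliceContract E k
      (extDeriv (pullbackVec (chartHomotopy E H p) (β k)) (s, y)) := by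
  rw [formInChart_homotopyOperator hH hβ.deRham k p hy]
  refine intervalIntegral.integral_congr fun s _ => ?_
  rw [hβ.extDeriv_pullbackVec k (contMDiffAt_chartHomotopy hH p s hy)]
  rfl

/-- **Homotopy formula**: `d K + K d = (H 1)^* - (H 0)^*` for the homotopy operator `K` of `H`. -/
theorem deRham_homotopyOperator_add [FiniteDimensional ℝ E] :
    deRham (homotopyOperator H β) + homotopyOperator H (deRham β)
      = pullback (H 1) β - pullback (H 0) β := by
  funext k p
  have hy := mem_extChartAt_target (I := 𝓘(ℝ, E)) p
  -- It suffices to compare the local representatives in the preferred chart around `p`.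
  suffices h : formInChart ((deRham (homotopyOperator H β) + homotopyOperator H (deRham β)) k) p
      (extChartAt 𝓘(ℝ, E) p p) = formInChart ((pullback (H 1) β - pullback (H 0) β) k) p
      (extChartAt 𝓘(ℝ, E) p p) by
    rw [eq_formInChart_comp ((deRham (homotopyOperator H β) + homotopyOperator H (deRham β)) k) p,
      h, ← eq_formInChart_comp]
  have hR : formInChart ((pullback (H 1) β - pullback (H 0) β) k) p (extChartAt 𝓘(ℝ, E) p p)
      = formInChart (pullback (H 1) β k) p (extChartAt 𝓘(ℝ, E) p p)
        - formInChart (pullback (H 0) β k) p (extChartAt 𝓘(ℝ, E) p p) := by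
    ext v; rfl
  have hL : formInChart ((deRham (homotopyOperator H β) + homotopyOperator H (deRham β)) k) p
      (extChartAt 𝓘(ℝ, E) p p)
      = formInChart (deRham (homotopyOperator H β) k) p (extChartAt 𝓘(ℝ, E) p p)
        + formInChart (homotopyOperator H (deRham β) k) p (extChartAt 𝓘(ℝ, E) p p) := by
    ext v; rfl
  rw [hR, hL, ← integral_deriv_slice hH hβ k p hy, formInChart_homotopyOperator_deRham hH hβ k p hy]
  have hdiff : ∀ s, DifferentiableAt ℝ (pullbackVec (chartHomotopy E H p) (β k))
      (s, extChartAt 𝓘(ℝ, E) p p) := fun s =>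
    (hβ.contDiffAt_pullbackVec k (contMDiffAt_chartHomotopy hH p s hy)).differentiableAt (by simp)
  cases k with
  | zero =>
    have h0 : formInChart (deRham (homotopyOperator H β) 0) p (extChartAt 𝓘(ℝ, E) p p) = 0 := by
      ext v; rfl
    rw [h0, zero_add]
    exact intervalIntegral.integral_congr fun s _ => extDeriv_slice_zero (hdiff s)
  | succ k =>
    have h1 : formInChart (deRham (homotopyOperator H β) (k + 1)) p (extChartAt 𝓘(ℝ, E) p p)
        = extDeriv (formInChart (homotopyOperator H β k) p) (extChartAt 𝓘(ℝ, E) p p) :=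
      ((isSmoothForm_homotopyOperator hH hβ).extDeriv_pullbackVec k
        (contMDiffAt_extChartAt_symm hy)).symm
    rw [h1, extDeriv_formInChart_homotopyOperator hH hβ k p hy,
      ← intervalIntegral.integral_add]
    · exact intervalIntegral.integral_congr fun s _ => extDeriv_slice_add (hdiff s)
    · refine Continuous.intervalIntegrable ?_ 0 1
      exact (alternatizeUncurryFinCLM ℝ E ℝ).continuous.comp (continuous_slice_of_contDiffAt
        fun s => ContDiffAt.fderiv_slice (contDiffAt_sliceContract hH hβ k p s hy))
    · refine Continuous.intervalIntegrable ?_ 0 1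
      refine (sliceContract E (k + 1)).continuous.comp ?_
      refine (alternatizeUncurryFinCLM ℝ (ℝ × E) ℝ).continuous.comp ?_
      exact continuous_slice_of_contDiffAt fun s => (hβ.contDiffAt_pullbackVec (k + 1)
        (contMDiffAt_chartHomotopy hH p s hy)).fderiv_right (m := ∞) (by simp)

end Homotopy

/-! ### Linearity and equivariance of the homotopy operator -/

section HomotopyEquivariance

open ContinuousAlternatingMap

variable {E : Type*} [NormedAddCommGroup E] [NormedSpace ℝ E]
  {M : Type*} [TopologicalSpace M] [ChartedSpace E M]

/-- Contractions with two vectors anticommute. -/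
theorem curryLeft_curryLeft_swap {k : ℕ} (f : E [⋀^Fin (k + 2)]→L[ℝ] ℝ) (v w : E) :
    (f.curryLeft v).curryLeft w = -(f.curryLeft w).curryLeft v := by
  have h := f.curryLeft_same (v + w)
  simp only [map_add, curryLeft_add, _root_.add_apply, curryLeft_same, zero_add,
    add_zero] at h
  exact eq_neg_of_add_eq_zero_right h

theorem IsSmoothForm.add {β γ : GradedForm E M} (hβ : IsSmoothForm β) (hγ : IsSmoothForm γ) :
    IsSmoothForm (β + γ) := fun k p => (hβ k p).add (hγ k p)

theorem pullback_add (f : M → M) (β γ : GradedForm E M) :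
    pullback f (β + γ) = pullback f β + pullback f γ := rfl

theorem pullback_neg (f : M → M) (β : GradedForm E M) :
    pullback f (-β) = -pullback f β := rfl

theorem pullback_id (β : GradedForm E M) : pullback (fun p : M => p) β = β := by
  funext k p
  have h : mderiv E E (fun p : M => p) p = ContinuousLinearMap.id ℝ E := mfderiv_id
  exact congrArg (fun L : E →L[ℝ] E => (asField (β k) p).compContinuousLinearMap L) h

theorem homotopyOperator_zero (H : ℝ → M → M) :
    homotopyOperator H (0 : GradedForm E M) = 0 := by
  funext k p
  have h : ∫ s in (0 : ℝ)..1, homotopyIntegrand H (0 : GradedForm E M) k s p = 0 :=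
    intervalIntegral.integral_zero
  exact h

theorem homotopyOperator_smul (H : ℝ → M → M) (c : ℝ) (β : GradedForm E M) :
    homotopyOperator H (c • β) = c • homotopyOperator H β := by
  funext k p
  exact intervalIntegral.integral_smul c (fun s => homotopyIntegrand H β k s p)

variable [IsManifold 𝓘(ℝ, E) ∞ M] {H : ℝ → M → M}
  (hH : ContMDiff (𝓘(ℝ, ℝ).prod 𝓘(ℝ, E)) 𝓘(ℝ, E) ∞ (fun q : ℝ × M => H q.1 q.2))
include hH

theorem homotopyOperator_add {β γ : GradedForm E M} (hβ : IsSmoothForm β) (hγ : IsSmoothForm γ) :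
    homotopyOperator H (β + γ) = homotopyOperator H β + homotopyOperator H γ := by
  funext k p
  exact intervalIntegral.integral_add
    ((continuous_homotopyIntegrand hH hβ k p).intervalIntegrable 0 1)
    ((continuous_homotopyIntegrand hH hγ k p).intervalIntegrable 0 1)

/-- The homotopy operator commutes with the pullback by a map that commutes with all `H s`. -/
theorem pullback_homotopyOperator [FiniteDimensional ℝ E] {β : GradedForm E M}
    (hβ : IsSmoothForm β) {f : M → M} (hf : ContMDiff 𝓘(ℝ, E) 𝓘(ℝ, E) ∞ f)
    (hcomm : ∀ s p, H s (f p) = f (H s p)) :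
    pullback f (homotopyOperator H β) = homotopyOperator H (pullback f β) := by
  funext k p
  have hfd : ∀ p, MDifferentiableAt 𝓘(ℝ, E) 𝓘(ℝ, E) f p := fun p => hf.mdifferentiableAt (by simp)
  have hint : ∀ s, (homotopyIntegrand H β k s (f p)).compContinuousLinearMap (mderiv E E f p)
      = homotopyIntegrand H (pullback f β) k s p := by
    intro s
    have hHd : ∀ p, MDifferentiableAt 𝓘(ℝ, E) 𝓘(ℝ, E) (H s) p := fun p =>
      (contMDiff_slice hH s).mdifferentiableAt (by simp)
    have hv : velocity H s (f p) = mderiv E E f (H s p) (velocity H s p) := by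
      have h := mderiv_comp (f := f) (g := fun t => H t p) (p := s) rfl (hfd _)
        ((contMDiff_curve hH p).mdifferentiableAt (by simp))
      simp only [velocity, hcomm]
      rw [h]
      rfl
    have hd : (mderiv E E (H s) (f p)).comp (mderiv E E f p)
        = (mderiv E E f (H s p)).comp (mderiv E E (H s) p) := by
      rw [← mderiv_comp (g := f) (p := p) rfl (hHd _) (hfd p),
        ← mderiv_comp (f := f) (g := H s) (p := p) rfl (hfd _) (hHd p)]
      simp only [hcomm]
    have hb : asField (β (k + 1)) (H s (f p)) = asField (β (k + 1)) (f (H s p)) := by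
      rw [hcomm]
    have hp : asField (pullback f β (k + 1)) (H s p)
        = (asField (β (k + 1)) (f (H s p))).compContinuousLinearMap (mderiv E E f (H s p)) := rfl
    rw [homotopyIntegrand, homotopyIntegrand, hb, hv, hp, curryLeft_compContinuousLinearMap]
    exact congrArg (fun L : E →L[ℝ] E => ((asField (β (k + 1)) (f (H s p))).curryLeft
      (mderiv E E f (H s p) (velocity H s p))).compContinuousLinearMap L) hd
  have hL : pullback f (homotopyOperator H β) k p = ∫ s in (0 : ℝ)..1,
      (homotopyIntegrand H β k s (f p)).compContinuousLinearMap (mderiv E E f p) :=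
    ((compContinuousLinearMapCLM (F := ℝ) (ι := Fin k) (mderiv E E f p)).intervalIntegral_comp_comm
      ((continuous_homotopyIntegrand hH hβ k _).intervalIntegrable 0 1)).symm
  rw [hL]
  simp only [hint]
  rfl

/-- The homotopy operator anticommutes with the contraction with a vector field preserved by all
`H s`. -/
theorem homotopyOperator_contract [FiniteDimensional ℝ E] {β : GradedForm E M}
    (hβ : IsSmoothForm β) {X : M → E}
    (hX : ∀ s p, mderiv E E (H s) p (X p) = X (H s p)) :
    homotopyOperator H (contract X β) = -contract X (homotopyOperator H β) := by
  funext k p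
  have hint : ∀ s, homotopyIntegrand H (contract X β) k s p
      = -(homotopyIntegrand H β (k + 1) s p).curryLeft (X p) := by
    intro s
    have h1 : asField (contract X β (k + 1)) (H s p)
        = (asField (β (k + 2)) (H s p)).curryLeft (X (H s p)) := rfl
    rw [homotopyIntegrand, homotopyIntegrand, h1, curryLeft_compContinuousLinearMap, hX s p,
      curryLeft_curryLeft_swap]
    rfl
  have hR : insertVector (X p : E) (∫ s in (0 : ℝ)..1, homotopyIntegrand H β (k + 1) s p)
      = ∫ s in (0 : ℝ)..1, (homotopyIntegrand H β (k + 1) s p).curryLeft (X p) :=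
    (((ContinuousLinearMap.apply ℝ (E [⋀^Fin k]→L[ℝ] ℝ) (X p)).comp
      (curryLeftLI (𝕜 := ℝ) (E := E) (F := ℝ)
        (n := k)).toContinuousLinearMap).intervalIntegral_comp_comm
      ((continuous_homotopyIntegrand hH hβ (k + 1) p).intervalIntegrable 0 1)).symm
  have hL : ∫ s in (0 : ℝ)..1, homotopyIntegrand H (contract X β) k s p
      = -insertVector (X p : E) (∫ s in (0 : ℝ)..1, homotopyIntegrand H β (k + 1) s p) := by
    rw [hR, ← intervalIntegral.integral_neg]
    exact intervalIntegral.integral_congr fun s _ => hint s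
  exact hL

end HomotopyEquivariance

/-! ### The action and the isotopy -/

section Action

variable {E : Type*} [NormedAddCommGroup E] [NormedSpace ℝ E]
  {M : Type*} [TopologicalSpace M] [ChartedSpace E M]
  {EG : Type*} [NormedAddCommGroup EG] [NormedSpace ℝ EG]
  {G : Type*} [TopologicalSpace G] [ChartedSpace EG G] [Group G] [MulAction G M]

/-- An equivariant map preserves the infinitesimal generators of the action. -/
theorem mderiv_generator [ContMDiffSMul 𝓘(ℝ, EG) 𝓘(ℝ, E) ∞ G M] {f : M → M}
    (hf : ContMDiff 𝓘(ℝ, E) 𝓘(ℝ, E) ∞ f) (hfG : ∀ (g : G) (p : M), f (g • p) = g • f p)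
    (x : GroupLieAlgebra 𝓘(ℝ, EG) G) (p : M) :
    mderiv E E f p (generator E M x p) = generator E M x (f p) := by
  have horbit : ContMDiff 𝓘(ℝ, EG) 𝓘(ℝ, E) ∞ (fun g : G => g • p) :=
    (contMDiff_smul (I := 𝓘(ℝ, EG)) (I' := 𝓘(ℝ, E)) (n := ∞) (G := G) (M := M)).comp
      (contMDiff_id.prodMk contMDiff_const)
  have h := mderiv_comp (f := f) (g := fun g : G => g • p) (p := 1) (one_smul G p)
    (hf.mdifferentiableAt (by simp)) (horbit.mdifferentiableAt (by simp))
  simp only [hfG] at h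
  have h1 : mderiv EG E (fun g : G => g • f p) 1 x
      = mderiv E E f p (mderiv EG E (fun g : G => g • p) 1 x) :=
    congrArg (fun L : EG →L[ℝ] E => L x) h
  have h2 : (generator E M x (f p) : E) = -(mderiv EG E (fun g : G => g • f p) 1 x) := rfl
  have h3 : (generator E M x p : E) = -(mderiv EG E (fun g : G => g • p) 1 x) := rfl
  rw [h2, h3, h1]
  exact map_neg _ _

omit [TopologicalSpace G] in
/-- An equivariant isotopy from the identity to `ψ`, reparametrized by a smooth cutoff so as to be
defined and smooth for all times, and run backwards. -/
theorem EquivariantlyIsotopicToId.exists_contMDiff {ψ : M ≃ₘ⟮𝓘(ℝ, E), 𝓘(ℝ, E)⟯ M}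
    (h : EquivariantlyIsotopicToId G ψ) :
    ∃ H : ℝ → M → M,
      ContMDiff (𝓘(ℝ, ℝ).prod 𝓘(ℝ, E)) 𝓘(ℝ, E) ∞ (fun q : ℝ × M => H q.1 q.2) ∧
      H 0 = ψ ∧ H 1 = (fun p => p) ∧ ∀ s (g : G) (p : M), H s (g • p) = g • H s p := by
  obtain ⟨Ψ, hΨ, h0, h1, hG⟩ := h
  have hmem : ∀ s : ℝ, Real.smoothTransition (1 - s) ∈ Set.Icc (0 : ℝ) 1 := fun s =>
    ⟨Real.smoothTransition.nonneg _, Real.smoothTransition.le_one _⟩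
  refine ⟨fun s => Ψ (Real.smoothTransition (1 - s)), ?_, ?_, ?_, fun s => hG _ (hmem s)⟩
  · have hχ : ContMDiff 𝓘(ℝ, ℝ) 𝓘(ℝ, ℝ) ∞ (fun s : ℝ => Real.smoothTransition (1 - s)) :=
      (Real.smoothTransition.contDiff.comp (contDiff_const.sub contDiff_id)).contMDiff
    exact hΨ.comp_contMDiff ((hχ.comp contMDiff_fst).prodMk contMDiff_snd)
      fun q => ⟨hmem q.1, Set.mem_univ _⟩
  · funext p
    simp [h1]
  · funext p
    simp [h0]

theorem neg_mem_equivariantLinearForms {j : ℤ}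
    {μ : GroupLieAlgebra 𝓘(ℝ, EG) G →ₗ[ℝ] GradedForm E M}
    (hμ : μ ∈ equivariantLinearForms E M EG G j) : -μ ∈ equivariantLinearForms E M EG G j := by
  have h : ∀ x, (-μ) x = μ (-x) := fun x => (map_neg μ x).symm
  refine ⟨fun x => by rw [h]; exact hμ.1 (-x), fun g x => ?_⟩
  simp only [LinearMap.neg_apply, pullback_neg]
  exact congrArg Neg.neg (hμ.2 g x)

/-- For a cocycle `α + ν` with `α ∈ Ω^{n+1}(M)` and `ν` linear with values in `Ω^{n-1}(M)`, the
component of the cocycle equation in form degree `n - 2` is `ι_{v_x} ν(x) = 0`. -/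
theorem IsCartanCocycle.contract_generator_eq_zero {n : ℕ} {α : GradedForm E M}
    {ν : GroupLieAlgebra 𝓘(ℝ, EG) G →ₗ[ℝ] GradedForm E M}
    (hα : IsHomogeneousForm ((n : ℤ) + 1) α) (hν : ∀ x, IsHomogeneousForm ((n : ℤ) - 1) (ν x))
    (hC : IsCartanCocycle (cartanSum α ν)) (x : GroupLieAlgebra 𝓘(ℝ, EG) G) :
    contract (generator E M x) (ν x) = 0 := by
  funext k
  by_cases hk : (k : ℤ) = n - 2
  · have h := congrFun (congrFun hC.2.2 x) k
    have hα0 : α (k + 1) = 0 := hα (k + 1) (by push_cast; omega)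
    have hd : deRham (cartanSum α ν x) k = 0 := by
      cases k with
      | zero => rfl
      | succ j =>
        have hj : cartanSum α ν x j = 0 := by
          have h1 : α j = 0 := hα j (by push_cast at hk; omega)
          have h2 : ν x j = 0 := hν x j (by push_cast at hk; omega)
          change α j + ν x j = 0
          rw [h1, h2, add_zero]
        have hchart : ∀ p : M, formInChart (E := E) (k := j)
            (0 : ∀ p : M, (TangentSpace 𝓘(ℝ, E) p) [⋀^Fin j]→L[ℝ] ℝ) p = fun _ => 0 :=
          fun p => rfl
        funext p
        change extDerivForm (cartanSum α ν x j) p = 0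
        have hext : ∀ y : E, extDeriv (fun _ : E => (0 : E [⋀^Fin j]→L[ℝ] ℝ)) y = 0 := by
          intro y
          rw [extDeriv, fderiv_fun_const]
          exact map_zero (ContinuousAlternatingMap.alternatizeUncurryFinCLM ℝ E ℝ)
        rw [hj, extDerivForm, hchart, hext]
        rfl
    have h2 : contract (generator E M x) (cartanSum α ν x) k
        = contract (generator E M x) (ν x) k := by
      funext p
      change insertVector _ ((α (k + 1) + ν x (k + 1)) p) = insertVector _ (ν x (k + 1) p)
      rw [hα0, zero_add]
    have h3 : deRham (cartanSum α ν x) k - contract (generator E M x) (cartanSum α ν x) k = 0 := h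
    rw [hd, h2, zero_sub, neg_eq_zero] at h3
    exact h3
  · have h0 : ν x (k + 1) = 0 := hν x (k + 1) (by push_cast; omega)
    funext p
    change insertVector _ (ν x (k + 1) p) = 0
    rw [h0]
    rfl

end Action

end EquivForms

end

theorem mainTheorem9
    {E : Type*} [NormedAddCommGroup E] [NormedSpace ℝ E] [FiniteDimensional ℝ E]
    {M : Type*} [TopologicalSpace M] [T2Space M] [SecondCountableTopology M]
    [ChartedSpace E M] [IsManifold 𝓘(ℝ, E) ∞ M]
    {EG : Type*} [NormedAddCommGroup EG] [NormedSpace ℝ EG] [FiniteDimensional ℝ EG]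
    {G : Type*} [TopologicalSpace G] [ChartedSpace EG G] [Group G] [LieGroup 𝓘(ℝ, EG) ∞ G]
    [MulAction G M] [ContMDiffSMul 𝓘(ℝ, EG) 𝓘(ℝ, E) ∞ G M]
    (n : ℕ)
    (ω₀ ω₁ : EquivForms.GradedForm E M)
    (hω₀ : ω₀ ∈ EquivForms.invariantForms E M G ((n : ℤ) + 1))
    (hω₁ : ω₁ ∈ EquivForms.invariantForms E M G ((n : ℤ) + 1))
    (μ₀ μ₁ : GroupLieAlgebra 𝓘(ℝ, EG) G →ₗ[ℝ] EquivForms.GradedForm E M)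
    (hμ₀ : μ₀ ∈ EquivForms.equivariantLinearForms E M EG G ((n : ℤ) - 1))
    (hμ₁ : μ₁ ∈ EquivForms.equivariantLinearForms E M EG G ((n : ℤ) - 1))
    (hC₀ : EquivForms.IsCartanCocycle (EquivForms.cartanSum ω₀ (-μ₀)))
    (hC₁ : EquivForms.IsCartanCocycle (EquivForms.cartanSum ω₁ (-μ₁)))
    (ψ : M ≃ₘ⟮𝓘(ℝ, E), 𝓘(ℝ, E)⟯ M)
    (hψ : ∀ (g : G) (p : M), ψ (g • p) = g • ψ p)
    (hiso : EquivForms.EquivariantlyIsotopicToId G ψ)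
    (hψω : EquivForms.pullback ψ ω₁ = ω₀)
    (hψμ : ∀ x, EquivForms.pullback ψ (μ₁ x) = μ₀ x) :
    EquivForms.CartanEquivalent n (EquivForms.cartanSum ω₀ (-μ₀))
      (EquivForms.cartanSum ω₁ (-μ₁)) := by
  open EquivForms in
  obtain ⟨H, hH, hH0, hH1, hHG⟩ := hiso.exists_contMDiff
  obtain ⟨hν, hνG⟩ := neg_mem_equivariantLinearForms hμ₁
  have hact : ∀ g : G, ContMDiff 𝓘(ℝ, E) 𝓘(ℝ, E) ∞ (fun p : M => g • p) := fun g =>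
    (contMDiff_smul (I := 𝓘(ℝ, EG)) (I' := 𝓘(ℝ, E)) (n := ∞) (G := G) (M := M)).comp
      (contMDiff_const.prodMk contMDiff_id)
  have hgen : ∀ (x : GroupLieAlgebra 𝓘(ℝ, EG) G) (s : ℝ) (p : M),
      mderiv E E (H s) p (generator E M x p) = generator E M x (H s p) := fun x s p =>
    mderiv_generator (contMDiff_slice hH s) (hHG s) x p
  -- `F = -K μ¹`, so that `α + F(x) = K (C¹(x))`.
  let F : GroupLieAlgebra 𝓘(ℝ, EG) G →ₗ[ℝ] GradedForm E M :=
    { toFun := fun x => homotopyOperator H ((-μ₁) x)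
      map_add' := fun x y => by
        rw [map_add, homotopyOperator_add hH (hν x).1 (hν y).1]
      map_smul' := fun c x => by
        rw [map_smul, homotopyOperator_smul, RingHom.id_apply] }
  refine ⟨homotopyOperator H ω₁, ⟨isSmoothForm_homotopyOperator hH hω₁.1, ?_, fun g => ?_⟩,
    F, ⟨fun x => ⟨isSmoothForm_homotopyOperator hH (hν x).1, ?_⟩, fun g x => ?_⟩, ?_, fun x => ?_⟩
  · simpa using hω₁.2.1.homotopyOperator (H := H)
  · rw [pullback_homotopyOperator hH hω₁.1 (hact g) fun s p => hHG s g p, hω₁.2.2 g]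
  · have h := (hν x).2.homotopyOperator (H := H)
    rwa [sub_sub] at h
  · change pullback _ (homotopyOperator H ((-μ₁) (Ad g x))) = homotopyOperator H ((-μ₁) x)
    rw [pullback_homotopyOperator hH (hν _).1 (hact g) fun s p => hHG s g p, hνG g x]
  · funext x
    have hsmooth : IsSmoothForm (cartanSum ω₁ (-μ₁) x) := hω₁.1.add (hν x).1
    have hsum : cartanSum (homotopyOperator H ω₁) F x
        = homotopyOperator H (cartanSum ω₁ (-μ₁) x) :=
      (homotopyOperator_add hH hω₁.1 (hν x).1).symm
    have hcoc : deRham (cartanSum ω₁ (-μ₁) x)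
        = contract (generator E M x) (cartanSum ω₁ (-μ₁) x) :=
      sub_eq_zero.1 (congrFun hC₁.2.2 x)
    have hhom := deRham_homotopyOperator_add hH hsmooth
    rw [hcoc, homotopyOperator_contract hH hsmooth (hgen x), hH0, hH1, pullback_id,
      ← sub_eq_add_neg] at hhom
    have hpull : pullback ψ (cartanSum ω₁ (-μ₁) x) = cartanSum ω₀ (-μ₀) x := by
      simp only [cartanSum, pullback_add, LinearMap.neg_apply, pullback_neg, hψω, hψμ]
    rw [hpull] at hhom
    change cartanSum ω₁ (-μ₁) x - cartanSum ω₀ (-μ₀) x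
      = deRham (cartanSum (homotopyOperator H ω₁) F x)
        - contract (generator E M x) (cartanSum (homotopyOperator H ω₁) F x)
    rw [hsum]
    exact hhom.symm
  · have h := hC₁.contract_generator_eq_zero hω₁.2.1 (fun x => (hν x).2) x
    change contract _ (homotopyOperator H ((-μ₁) x)) = 0
    rw [← neg_eq_zero, ← homotopyOperator_contract hH (hν x).1 (hgen x), h,
      homotopyOperator_zero]
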